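/- Let $\mathbb X\subset\mathbb R^d$ be a Borel set, let $\mathbb U\subset\mathbb R^m$ be compact, let $c:\mathbb X\times\mathbb U\to\mathbb R$ be bounded and continuous, and let $\mathcal T$ and $\mathcal T_n$ $(n\in\mathbb N)$ be stochastic kernels from $\mathbb X\times\mathbb U$ to $\mathbb X$. An admissible policy is a sequence $\gamma=(\gamma_t)_{t\ge0}$ of measurable functions giving the actions $U_t=\gamma_t(X_0,\dots,X_t,U_0,\dots,U_{t-1})$; it is stationary if $U_t=\gamma(X_t)$ for all $t$, with one measurable $\gamma:\mathbb X\to\mathbb U$. Fix an initial state $x_0\in\mathbb X$ and a class $\Gamma$ of admissible policies that contains all stationary ones (for instance all stationary policies, or all admissible policies). Set $$J_\infty(\mathcal T,\gamma)=\limsup_{N\to\infty}\frac1N E^{\mathcal T,\gamma}_{x_0}\Big[\sum_{t=0}^{N-1}c(X_t,U_t)\Big],\qquad J^*_\infty(\mathcal T)=\inf_{\gamma\in\Gamma}J_\infty(\mathcal T,\gamma),$$ where under $E^{\mathcal T,\gamma}_{x_0}$ the process starts at $X_0=x_0$ and $X_{t+1}\sim\mathcal T(\cdot\,|X_t,U_t)$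 given the past. Assume the following. 1. The maps $(x,u)\mapsto\mathcal T(\cdot|x,u)$ and $(x,u)\mapsto\mathcal T_n(\cdot|x,u)$, for every $n$, are weakly continuous, and $\mathcal T_n(\cdot|x_n,u_n)\to\mathcal T(\cdot|x,u)$ weakly whenever $(x_n,u_n)\to(x,u)$ in $\mathbb X\times\mathbb U$. 2. For every stationary policy $\gamma$, the Markov chains on $\mathbb X$ with transition kernels $\mathcal T(\cdot|x,\gamma(x))$ and $\mathcal T_n(\cdot|x,\gamma(x))$, $n\in\mathbb N$, are positive Harris recurrent: there is a nonzero $\sigma$-finite measure $\varphi$ such that every measurable set $A$ with $\varphi(A)>0$ is visited infinitely often almost surely from every initial state, and an invariant probability measure exists. (The invariant probability measures, which are then unique, are denoted by $\pi^\gamma$ and $\pi^\gamma_n$.) 3. The families $\{\pi^\gamma\}_\gamma$ and $\{\pi_n^\gamma\}_{\gamma,n}$, where $\gamma$ ranges over all stationary policies, are tight. 4. There are stationary policies $\gamma^*$ and $\gamma_n^*$ with $J_\infty(\mathcal T,\gamma^*)=J_\infty^*(\mathcal T)$ and $J_\infty(\mathcal T_n,\gamma_n^*)=J_\infty^*(\mathcal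 T_n)$ for every $n$, such that $\gamma^*$ is continuous and the family $\{\gamma_n^*\}_n$ is equicontinuous. Then, as $n\to\infty$, $$J_\infty^*(\mathcal T_n)\to J_\infty^*(\mathcal T)\qquad\text{and}\qquad J_\infty(\mathcal T,\gamma_n^*)\to J_\infty^*(\mathcal T).$$ -/

import Mathlib

open MeasureTheory ProbabilityTheory Filter Topology

noncomputable section

namespace AvgCost

section Policies

variable (X U : Type*) [MeasurableSpace X] [MeasurableSpace U]

/-- An admissible policy: a sequence of measurable control functions. The action `U₀` is a
function of `X₀`, and `U_{t+1}` is a function of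
`((X₀, U₀), …, (X_t, U_t))` and `X_{t+1}`. -/
structure AdmissiblePolicy where
  init : X → U
  measurable_init : Measurable init
  step : (t : ℕ) → (Finset.Iic t → X × U) × X → U
  measurable_step : ∀ t, Measurable (step t)

/-- A stationary (deterministic, Markov, time-homogeneous) policy: a measurable map from states
to actions, used as `U_t = γ (X_t)`. -/
abbrev StationaryPolicy := {γ : X → U // Measurable γ}

end Policies

variable {X U : Type*} [MeasurableSpace X] [MeasurableSpace U]

/-- A stationary policy, seen as an admissible policy. -/
def StationaryPolicy.toAdmissible (γ : StationaryPolicy X U) : AdmissiblePolicy X U where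
  init := γ.1
  measurable_init := γ.2
  step _ h := γ.1 h.2
  measurable_step _ := γ.2.comp measurable_snd

/-- The conditional law of `(X_{t+1}, U_{t+1})` given `((X₀, U₀), …, (X_t, U_t)) = h` under the
transition kernel `T` and the policy `γ`: the next state is drawn from `T(· | x_t, u_t)` and the
next action is `γ_{t+1}(h, X_{t+1})`. -/
def stepKernel (T : Kernel (X × U) X) (γ : AdmissiblePolicy X U) (t : ℕ) :
    Kernel (Finset.Iic t → X × U) (X × U) :=
  (Kernel.id ×ₖ T.comap (fun h : Finset.Iic t → X × U => h ⟨t, Finset.mem_Iic.2 le_rfl⟩)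
    (measurable_pi_apply _)).map (fun p => (p.2, γ.step t p))

instance (T : Kernel (X × U) X) [IsMarkovKernel T] (γ : AdmissiblePolicy X U) (t : ℕ) :
    IsMarkovKernel (stepKernel T γ t) :=
  Kernel.IsMarkovKernel.map _ (measurable_snd.prodMk (γ.measurable_step t))

/-- The law of the state-action process `(X_t, U_t)_{t ≥ 0}` with initial state `x₀`. -/
def processLaw (T : Kernel (X × U) X) [IsMarkovKernel T] (γ : AdmissiblePolicy X U) (x₀ : X) :
    Measure (ℕ → X × U) :=
  Kernel.traj (X := fun _ => X × U) (stepKernel T γ) 0 (fun _ => (x₀, γ.init x₀))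

/-- The infinite-horizon average expected cost
`limsup_N (1/N) E[∑_{t < N} c(X_t, U_t)]` of the policy `γ` under `T`, started at `x₀`.
It is used for bounded measurable costs `c` only. -/
def avgCost (T : Kernel (X × U) X) [IsMarkovKernel T] (c : X × U → ℝ) (x₀ : X)
    (γ : AdmissiblePolicy X U) : ℝ :=
  limsup (fun N : ℕ => (1 / (N : ℝ)) *
    ∫ ω, ∑ t ∈ Finset.range N, c (ω t) ∂(processLaw T γ x₀)) atTop

/-- The optimal average cost over a class `Γ` of policies. -/
def optCost (T : Kernel (X × U) X) [IsMarkovKernel T] (c : X × U → ℝ) (x₀ : X)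
    (Γ : Set (AdmissiblePolicy X U)) : ℝ :=
  ⨅ γ : Γ, avgCost T c x₀ γ

/-- The transition kernel `T(· | x, γ(x))` of the state process under a stationary policy. -/
def closedLoop (T : Kernel (X × U) X) (γ : StationaryPolicy X U) : Kernel X X :=
  T.comap (fun x => (x, γ.1 x)) (measurable_id.prodMk γ.2)

instance (T : Kernel (X × U) X) [IsMarkovKernel T] (γ : StationaryPolicy X U) :
    IsMarkovKernel (closedLoop T γ) := by
  unfold closedLoop; infer_instance

/-- The law of the time-homogeneous Markov chain with transition kernel `P` started at `x`. -/
def chainLaw (P : Kernel X X) [IsMarkovKernel P] (x : X) : Measure (ℕ → X) :=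
  Kernel.traj (X := fun _ => X)
    (fun t => P.comap (fun h : Finset.Iic t → X => h ⟨t, Finset.mem_Iic.2 le_rfl⟩)
      (measurable_pi_apply _)) 0 (fun _ => x)

/-- Positive Harris recurrence: there is a nontrivial σ-finite measure `φ` such that, from every
initial state, every measurable set of positive `φ`-measure is almost surely visited infinitely
often, and the chain has an invariant probability measure. -/
def IsPositiveHarris (P : Kernel X X) [IsMarkovKernel P] : Prop :=
  (∃ φ : Measure X, SigmaFinite φ ∧ φ ≠ 0 ∧
    ∀ A : Set X, MeasurableSet A → 0 < φ A →
      ∀ x : X, ∀ᵐ ω ∂(chainLaw P x), ∃ᶠ t in atTop, ω t ∈ A) ∧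
  ∃ π : Measure X, IsProbabilityMeasure π ∧ P.Invariant π

/-- All probability measures that are invariant for `T` under some stationary policy. -/
def invariantMeasures (T : Kernel (X × U) X) : Set (Measure X) :=
  {π | IsProbabilityMeasure π ∧ ∃ γ : StationaryPolicy X U, (closedLoop T γ).Invariant π}

/-- The value of a Markov kernel at a point, in the space of probability measures with the
topology of weak convergence. -/
def kernelAt {Y : Type*} [MeasurableSpace Y] (T : Kernel Y X) [IsMarkovKernel T] (y : Y) :
    ProbabilityMeasure X :=
  ⟨T y, inferInstance⟩

end AvgCost

end

/-!
By Harris recurrence the average cost of a stationary policy is the mean of the cost under the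
invariant probability measure. The ergodic theorem behind this needs no aperiodicity or
minorization. Let `f` have negative invariant mean, and consider the problem of stopping the
accumulated reward `f` optimally. The states whose infinite-horizon value is finite form an
absorbing set, and the maximal ergodic inequality shows that it is nonempty. Hence Harris
recurrence eventually traps the chain in it, and there the partial sums of the expected rewards
are bounded above. Applying this to `± f` shifted by constants gives convergence of the Cesàro
averages.

Now let kernels and policies converge continuously. Every weak limit of the invariant measures is
invariant for the limit kernel, so Prokhorov's theorem and uniqueness give their weak convergence,
and with it that of the average costs. By compactness of the action space, along every ultrafilter
the optimal policies converge continuously to some policy. Its cost is the limit of the optimal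
costs; comparison with the fixed policy that is optimal for the limit kernel shows that it is
optimal.
-/

namespace AvgCost

variable {E F X Y : Type*} [MeasurableSpace E] [MeasurableSpace F] [MeasurableSpace X]
  [MeasurableSpace Y]

/-! ### The transition operator of a Markov kernel -/

/-- A bounded measurable real function: the functions on which the transition operator of a Markov
kernel is free of integrability conditions. -/
structure BddMeasurable (f : E → ℝ) : Prop where
  measurable : Measurable f
  bounded : ∃ C : ℝ, ∀ x, |f x| ≤ C

namespace BddMeasurable

variable {f g : E → ℝ}

lemma integrable (hf : BddMeasurable f) (μ : Measure E) [IsFiniteMeasure μ] :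
    Integrable f μ :=
  let ⟨C, hC⟩ := hf.bounded
  .of_bound hf.measurable.aestronglyMeasurable C (ae_of_all _ hC)

lemma comp (hf : BddMeasurable f) {φ : F → E} (hφ : Measurable φ) :
    BddMeasurable (fun x => f (φ x)) :=
  ⟨hf.measurable.comp hφ, hf.bounded.imp fun _ hC _ => hC _⟩

lemma const (a : ℝ) : BddMeasurable (fun _ : E => a) := ⟨measurable_const, |a|, fun _ => le_rfl⟩

lemma add (hf : BddMeasurable f) (hg : BddMeasurable g) : BddMeasurable (fun x => f x + g x) :=
  let ⟨C, hC⟩ := hf.bounded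
  let ⟨D, hD⟩ := hg.bounded
  ⟨hf.measurable.add hg.measurable, C + D,
    fun x => (abs_add_le _ _).trans (add_le_add (hC x) (hD x))⟩

lemma neg (hf : BddMeasurable f) : BddMeasurable (fun x => -f x) :=
  ⟨hf.measurable.neg, hf.bounded.imp fun _ hC x => (abs_neg _).trans_le (hC x)⟩

lemma sub_const (hf : BddMeasurable f) (a : ℝ) : BddMeasurable (fun x => f x - a) := by
  simpa only [sub_eq_add_neg] using hf.add (const (-a))

lemma const_mul (hf : BddMeasurable f) (a : ℝ) : BddMeasurable (fun x => a * f x) := by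
  obtain ⟨C, hC⟩ := hf.bounded
  refine ⟨hf.measurable.const_mul a, |a| * C, fun x => ?_⟩
  rw [abs_mul]
  exact mul_le_mul_of_nonneg_left (hC x) (abs_nonneg a)

lemma sup (hf : BddMeasurable f) (hg : BddMeasurable g) : BddMeasurable (fun x => f x ⊔ g x) :=
  let ⟨C, hC⟩ := hf.bounded
  let ⟨D, hD⟩ := hg.bounded
  ⟨hf.measurable.max hg.measurable, C ⊔ D,
    fun x => abs_max_le_max_abs_abs.trans (max_le_max (hC x) (hD x))⟩

lemma indicator (hf : BddMeasurable f) {A : Set E} (hA : MeasurableSet A) :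
    BddMeasurable (A.indicator f) :=
  ⟨hf.measurable.indicator hA, hf.bounded.imp fun _ hC x =>
    (norm_indicator_le_norm_self f x).trans (hC x)⟩

lemma sum {ι : Type*} (s : Finset ι) {f : ι → E → ℝ} (hf : ∀ i, BddMeasurable (f i)) :
    BddMeasurable (fun x => ∑ i ∈ s, f i x) := by
  classical
  induction s using Finset.induction_on with
  | empty => simpa only [Finset.sum_empty] using const (E := E) 0
  | insert i s hi ih => simpa only [Finset.sum_insert hi] using (hf i).add ih

end BddMeasurable

/-- The transition operator `P f x = ∫ f dP(x, ·)` of a kernel `P`, acting on functions. -/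
noncomputable def transition (P : Kernel Y X) (f : X → ℝ) : Y → ℝ := fun y => ∫ x, f x ∂P y

lemma abs_transition_le (P : Kernel Y X) [IsMarkovKernel P] {f : X → ℝ} {C : ℝ}
    (hC : ∀ x, |f x| ≤ C) (y : Y) : |transition P f y| ≤ C := by
  simpa [transition] using
    norm_integral_le_of_norm_le_const (μ := P y) (f := f) (ae_of_all _ hC)

lemma BddMeasurable.transition {f : X → ℝ} (hf : BddMeasurable f) (P : Kernel Y X)
    [IsMarkovKernel P] : BddMeasurable (transition P f) :=
  ⟨(hf.measurable.stronglyMeasurable.integral_kernel (κ := P)).measurable,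
    hf.bounded.imp fun _ hC => abs_transition_le P hC⟩

lemma transition_mono (P : Kernel Y X) [IsMarkovKernel P] {f g : X → ℝ} (hf : BddMeasurable f)
    (hg : BddMeasurable g) (h : ∀ x, f x ≤ g x) (y : Y) : transition P f y ≤ transition P g y :=
  integral_mono (hf.integrable _) (hg.integrable _) h

lemma transition_sum (P : Kernel Y X) [IsMarkovKernel P] {ι : Type*} (s : Finset ι)
    {f : ι → X → ℝ} (hf : ∀ i, BddMeasurable (f i)) :
    transition P (fun x => ∑ i ∈ s, f i x) = fun y => ∑ i ∈ s, transition P (f i) y :=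
  funext fun _ => integral_finsetSum _ fun i _ => (hf i).integrable _

lemma integral_transition (P : Kernel Y X) [IsMarkovKernel P] {f : X → ℝ} (hf : BddMeasurable f)
    (μ : Measure Y) [IsFiniteMeasure μ] : ∫ y, transition P f y ∂μ = ∫ x, f x ∂(P ∘ₘ μ) := by
  have hint := hf.integrable (P ∘ₘ μ)
  rw [Measure.comp_eq_comp_const_apply] at hint
  rw [Measure.comp_eq_comp_const_apply, Kernel.integral_comp hint, Kernel.const_apply]
  rfl

lemma integral_transition_of_invariant (P : Kernel X X) [IsMarkovKernel P] {f : X → ℝ}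
    (hf : BddMeasurable f) {π : Measure X} [IsFiniteMeasure π] (hπ : P.Invariant π) :
    ∫ x, transition P f x ∂π = ∫ x, f x ∂π := by
  rw [integral_transition P hf, hπ.def]

section Iterate

variable (P : Kernel X X)

lemma iterate_transition_neg (f : X → ℝ) (t : ℕ) (x : X) :
    (transition P)^[t] (fun x => -f x) x = -(transition P)^[t] f x := by
  induction t generalizing f with
  | zero => rfl
  | succ t ih =>
    have hneg : transition P (fun x => -f x) = fun x => -transition P f x :=
      funext fun _ => integral_neg _
    rw [Function.iterate_succ_apply, Function.iterate_succ_apply, hneg, ih]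

variable [IsMarkovKernel P]

lemma BddMeasurable.iterate_transition {f : X → ℝ} (hf : BddMeasurable f) (t : ℕ) :
    BddMeasurable ((AvgCost.transition P)^[t] f) := by
  induction t with
  | zero => exact hf
  | succ t ih => rw [Function.iterate_succ_apply']; exact ih.transition P

lemma abs_iterate_transition_le {f : X → ℝ} {C : ℝ} (hC : ∀ x, |f x| ≤ C) (t : ℕ) (x : X) :
    |(transition P)^[t] f x| ≤ C := by
  induction t generalizing x with
  | zero => exact hC x
  | succ t ih => rw [Function.iterate_succ_apply']; exact abs_transition_le P ih x

lemma iterate_transition_sub_const {f : X → ℝ} (hf : BddMeasurable f) (a : ℝ) (t : ℕ) (x : X) :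
    (transition P)^[t] (fun x => f x - a) x = (transition P)^[t] f x - a := by
  induction t generalizing f with
  | zero => rfl
  | succ t ih =>
    have hsub : transition P (fun x => f x - a) = fun x => transition P f x - a :=
      funext fun x => by
        simp [transition, integral_sub (hf.integrable (P x)) (integrable_const a)]
    rw [Function.iterate_succ_apply, Function.iterate_succ_apply, hsub, ih (hf.transition P)]

end Iterate

/-! ### Cesàro averages of the transition operator -/

lemma abs_sum_range_le {a : ℕ → ℝ} {C : ℝ} (ha : ∀ t, |a t| ≤ C) {n : ℕ} :
    |∑ t ∈ Finset.range n, a t| ≤ n * C := by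
  simpa using (Finset.abs_sum_le_sum_abs a (Finset.range n)).trans
    (Finset.sum_le_card_nsmul _ _ C fun t _ => ha t)

lemma abs_one_div_mul_le {S C : ℝ} {n : ℕ} (hC : 0 ≤ C) (hS : |S| ≤ n * C) :
    |1 / (n : ℝ) * S| ≤ C := by
  rw [one_div_mul_eq_div, abs_div, Nat.abs_cast]
  exact div_le_of_le_mul₀ n.cast_nonneg hC (by rwa [mul_comm])

section Cesaro

variable (P : Kernel X X)

/-- The `n`-step potential `∑_{t < n} P^t f (x)`. It is a Birkhoff sum of the dynamical system
`transition P` on functions, observed through evaluation at `x`. -/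
noncomputable def potential (f : X → ℝ) (n : ℕ) (x : X) : ℝ :=
  birkhoffSum (transition P) (Function.eval x) n f

/-- The Cesàro average `(1 / n) ∑_{t < n} P^t f (x)`, with value `0` at `n = 0`. -/
noncomputable def cesaro (f : X → ℝ) (n : ℕ) (x : X) : ℝ :=
  birkhoffAverage ℝ (transition P) (Function.eval x) n f

lemma cesaro_eq_inv_mul_potential (f : X → ℝ) (n : ℕ) (x : X) :
    cesaro P f n x = (n : ℝ)⁻¹ * potential P f n x := rfl

lemma cesaro_neg (f : X → ℝ) (n : ℕ) (x : X) :
    cesaro P (fun x => -f x) n x = -cesaro P f n x := by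
  simp [cesaro, birkhoffAverage, birkhoffSum, iterate_transition_neg]

variable [IsMarkovKernel P]

lemma BddMeasurable.potential {f : X → ℝ} (hf : BddMeasurable f) (n : ℕ) :
    BddMeasurable (potential P f n) :=
  .sum (Finset.range n) fun t => hf.iterate_transition P t

lemma BddMeasurable.cesaro {f : X → ℝ} (hf : BddMeasurable f) (n : ℕ) :
    BddMeasurable (cesaro P f n) :=
  (hf.potential P n).const_mul _

lemma transition_potential {f : X → ℝ} (hf : BddMeasurable f) (n : ℕ) :
    transition P (potential P f n) = potential P (transition P f) n := by
  refine (transition_sum P (Finset.range n) fun t => hf.iterate_transition P t).trans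
    (funext fun x => Finset.sum_congr rfl fun t _ => ?_)
  exact congrFun (Function.Commute.self_iterate (transition P) t f) x

lemma potential_succ {f : X → ℝ} (hf : BddMeasurable f) (n : ℕ) (x : X) :
    potential P f (n + 1) x = f x + transition P (potential P f n) x := by
  rw [transition_potential P hf]
  exact birkhoffSum_succ' _ _ _ _

lemma abs_cesaro_le {f : X → ℝ} {C : ℝ} (hC : ∀ x, |f x| ≤ C) (n : ℕ) (x : X) :
    |cesaro P f n x| ≤ C := by
  rw [cesaro_eq_inv_mul_potential, ← one_div]
  exact abs_one_div_mul_le ((abs_nonneg _).trans (hC x))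
    (abs_sum_range_le fun t => abs_iterate_transition_le P hC t x)

lemma cesaro_sub_const {f : X → ℝ} (hf : BddMeasurable f) (a : ℝ) {n : ℕ} (hn : n ≠ 0) (x : X) :
    cesaro P (fun x => f x - a) n x = cesaro P f n x - a := by
  simp [cesaro, birkhoffAverage, birkhoffSum, iterate_transition_sub_const P hf, mul_sub, hn]

lemma transition_cesaro {f : X → ℝ} (hf : BddMeasurable f) (n : ℕ) :
    transition P (cesaro P f n) = cesaro P (transition P f) n := by
  funext x
  rw [cesaro_eq_inv_mul_potential, ← transition_potential P hf]
  exact integral_const_mul _ _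

lemma iterate_transition_cesaro {f : X → ℝ} (hf : BddMeasurable f) (n t : ℕ) :
    (transition P)^[t] (cesaro P f n) = cesaro P ((transition P)^[t] f) n := by
  induction t generalizing f with
  | zero => rfl
  | succ t ih =>
    rw [Function.iterate_succ_apply, transition_cesaro P hf, ih (hf.transition P),
      Function.iterate_succ_apply]

lemma tendsto_iterate_transition_cesaro_sub {f : X → ℝ} (hf : BddMeasurable f) (t : ℕ) (x : X) :
    Tendsto (fun n => (transition P)^[t] (cesaro P f n) x - cesaro P f n x) atTop (𝓝 0) := by
  induction t with
  | zero => simp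
  | succ t ih =>
    have hbdd : Bornology.IsBounded (Set.range fun k =>
        Function.eval x ((transition P)^[k] ((transition P)^[t] f))) := by
      obtain ⟨C, hC⟩ := (hf.iterate_transition P t).bounded
      refine isBounded_iff_forall_norm_le.2 ⟨C, ?_⟩
      rintro _ ⟨k, rfl⟩
      exact abs_iterate_transition_le P hC k x
    have hstep := (tendsto_birkhoffAverage_apply_sub_birkhoffAverage ℝ hbdd).add ih
    rw [add_zero] at hstep
    refine hstep.congr fun n => ?_
    rw [iterate_transition_cesaro P hf, iterate_transition_cesaro P hf,
      Function.iterate_succ_apply']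
    exact sub_add_sub_cancel _ _ _

end Cesaro

/-! ### Trajectories -/

section Trajectory

variable (κ : (t : ℕ) → Kernel (Finset.Iic t → E) E) [∀ t, IsMarkovKernel (κ t)]
  (h₀ : Finset.Iic 0 → E)

lemma map_traj_frestrictLe_zero :
    (Kernel.traj (X := fun _ => E) κ 0 h₀).map (Preorder.frestrictLe 0) = Measure.dirac h₀ := by
  rw [Kernel.traj_map_frestrictLe_apply, Kernel.partialTraj_self, Kernel.id_apply]

lemma map_traj_succ (t : ℕ) :
    (Kernel.traj (X := fun _ => E) κ 0 h₀).map
        (fun ω => (Preorder.frestrictLe (π := fun _ => E) t ω, ω (t + 1))) =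
      (Kernel.traj (X := fun _ => E) κ 0 h₀).map (Preorder.frestrictLe t) ⊗ₘ κ t := by
  rw [Kernel.traj_map_frestrictLe_apply, Kernel.partialTraj_compProd_eq_map_traj zero_le]

lemma integral_traj_zero {g : E → ℝ} (hg : BddMeasurable g) :
    ∫ ω, g (ω 0) ∂(Kernel.traj (X := fun _ => E) κ 0 h₀) = g (h₀ ⟨0, Finset.mem_Iic.2 le_rfl⟩) := by
  have hmeas : Measurable fun h : Finset.Iic 0 → E => g (h ⟨0, Finset.mem_Iic.2 le_rfl⟩) :=
    hg.measurable.comp (measurable_pi_apply _)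
  rw [← integral_dirac' _ h₀ hmeas.stronglyMeasurable, ← map_traj_frestrictLe_zero κ h₀,
    integral_map (Preorder.measurable_frestrictLe 0).aemeasurable hmeas.aestronglyMeasurable]
  rfl

lemma integral_traj_succ (t : ℕ) {g : E → ℝ} (hg : BddMeasurable g) :
    ∫ ω, g (ω (t + 1)) ∂(Kernel.traj (X := fun _ => E) κ 0 h₀) =
      ∫ ω, transition (κ t) g (Preorder.frestrictLe t ω)
        ∂(Kernel.traj (X := fun _ => E) κ 0 h₀) := by
  have hfst := Preorder.measurable_frestrictLe (X := fun _ => E) t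
  have hpair : Measurable fun ω : ℕ → E =>
      (Preorder.frestrictLe (π := fun _ => E) t ω, ω (t + 1)) := by fun_prop
  have hsnd := hg.comp (measurable_snd (α := Finset.Iic t → E))
  have : IsProbabilityMeasure
      ((Kernel.traj (X := fun _ => E) κ 0 h₀).map (Preorder.frestrictLe t)) :=
    Measure.isProbabilityMeasure_map hfst.aemeasurable
  rw [← integral_map hfst.aemeasurable (hg.transition (κ t)).measurable.aestronglyMeasurable]
  refine Eq.trans ?_ (Measure.integral_compProd (hsnd.integrable _))
  rw [← map_traj_succ, integral_map hpair.aemeasurable hsnd.measurable.aestronglyMeasurable]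

lemma ae_traj_succ (t : ℕ) {p : (Finset.Iic t → E) × E → Prop} (hp : MeasurableSet {q | p q})
    (h : ∀ h, ∀ᵐ y ∂κ t h, p (h, y)) :
    ∀ᵐ ω ∂(Kernel.traj (X := fun _ => E) κ 0 h₀), p (Preorder.frestrictLe t ω, ω (t + 1)) := by
  refine ae_of_ae_map (by fun_prop) ?_
  rw [map_traj_succ]
  exact Measure.ae_compProd_of_ae_ae hp (ae_of_all _ h)

end Trajectory

section Chain

variable (P : Kernel X X) [IsMarkovKernel P] (x : X)

instance : IsProbabilityMeasure (chainLaw P x) := by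
  unfold chainLaw; infer_instance

lemma integral_chainLaw (t : ℕ) {g : X → ℝ} (hg : BddMeasurable g) :
    ∫ ω, g (ω t) ∂(chainLaw P x) = (transition P)^[t] g x := by
  induction t generalizing g with
  | zero => exact integral_traj_zero _ _ hg
  | succ t ih =>
    rw [Function.iterate_succ_apply, ← ih (hg.transition P)]
    exact integral_traj_succ _ _ t hg

/-- A set that the chain with transition kernel `P` almost surely does not leave in one step. -/
def IsAbsorbing (A : Set X) : Prop := ∀ x ∈ A, ∀ᵐ y ∂P x, y ∈ A

variable {P} {A : Set X}

lemma IsAbsorbing.ae_chainLaw_succ (hA : IsAbsorbing P A) (hAm : MeasurableSet A) :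
    ∀ᵐ ω ∂(chainLaw P x), ∀ t, ω t ∈ A → ω (t + 1) ∈ A := by
  refine ae_all_iff.2 fun t => ?_
  have hlast : Measurable fun q : (Finset.Iic t → X) × X => q.1 ⟨t, Finset.mem_Iic.2 le_rfl⟩ := by
    fun_prop
  exact ae_traj_succ (p := fun q => q.1 ⟨t, Finset.mem_Iic.2 le_rfl⟩ ∈ A → q.2 ∈ A) _ _ t
    ((hlast hAm).imp (measurable_snd hAm)) fun h =>
      eventually_imp_distrib_left.2 fun hx => hA _ hx

lemma ae_chainLaw_zero_mem (hAm : MeasurableSet A) (hx : x ∈ A) :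
    ∀ᵐ ω ∂(chainLaw P x), ω 0 ∈ A := by
  refine ae_of_ae_map (f := Preorder.frestrictLe (π := fun _ => X) 0)
    (p := fun h => h ⟨0, Finset.mem_Iic.2 le_rfl⟩ ∈ A) (by fun_prop) ?_
  rw [chainLaw, map_traj_frestrictLe_zero]
  exact (ae_dirac_iff (measurable_pi_apply _ hAm)).2 hx

lemma IsAbsorbing.ae_forall_mem (hA : IsAbsorbing P A) (hAm : MeasurableSet A) (hx : x ∈ A) :
    ∀ᵐ ω ∂(chainLaw P x), ∀ t, ω t ∈ A := by
  filter_upwards [ae_chainLaw_zero_mem x hAm hx, hA.ae_chainLaw_succ x hAm] with ω h0 hsucc t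
  exact Nat.rec h0 hsucc t

end Chain

/-! ### Harris recurrence and the ergodic theorem -/

section Harris

/-- Harris recurrence, the first half of `IsPositiveHarris`. -/
def IsHarrisRecurrent (P : Kernel X X) [IsMarkovKernel P] : Prop :=
  ∃ φ : Measure X, SigmaFinite φ ∧ φ ≠ 0 ∧ ∀ A : Set X, MeasurableSet A → 0 < φ A →
    ∀ x : X, ∀ᵐ ω ∂(chainLaw P x), ∃ᶠ t in atTop, ω t ∈ A

variable {P : Kernel X X} [IsMarkovKernel P] {A : Set X}

lemma IsHarrisRecurrent.ae_eventually_mem (hP : IsHarrisRecurrent P) (hA : IsAbsorbing P A)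
    (hAm : MeasurableSet A) (hne : A.Nonempty) (x : X) :
    ∀ᵐ ω ∂(chainLaw P x), ∀ᶠ t in atTop, ω t ∈ A := by
  obtain ⟨φ, -, hφ, hvisit⟩ := hP
  obtain ⟨a, ha⟩ := hne
  have hcompl : φ Aᶜ = 0 := by
    by_contra hpos
    obtain ⟨ω, hin, hout⟩ := ((hA.ae_forall_mem a hAm ha).and
      (hvisit _ hAm.compl (pos_iff_ne_zero.2 hpos) a)).exists
    exact hout (Eventually.of_forall fun t => not_not.2 (hin t))
  have hpos : 0 < φ A := by
    refine pos_iff_ne_zero.2 fun hzero => hφ (Measure.measure_univ_eq_zero.1 ?_)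
    rw [← Set.union_compl_self A]
    exact measure_union_null hzero hcompl
  filter_upwards [hvisit A hAm hpos x, hA.ae_chainLaw_succ x hAm] with ω hfreq hsucc
  obtain ⟨s, hs⟩ := hfreq.exists
  filter_upwards [eventually_ge_atTop s] with t hst
  exact Nat.le_induction hs (fun t _ => hsucc t) t hst

/-- The value of the optimal stopping problem with running reward `f` and horizon `n`, by backward
recursion. -/
noncomputable def stoppingValue (P : Kernel X X) (f : X → ℝ) : ℕ → X → ℝ
  | 0 => fun _ => 0
  | n + 1 => fun x => (f x + transition P (stoppingValue P f n) x) ⊔ 0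

variable {f : X → ℝ}

lemma BddMeasurable.stoppingValue (hf : BddMeasurable f) (n : ℕ) :
    BddMeasurable (stoppingValue P f n) := by
  induction n with
  | zero => exact .const 0
  | succ n ih => exact (hf.add (ih.transition P)).sup (.const 0)

lemma stoppingValue_mono (hf : BddMeasurable f) (x : X) :
    Monotone fun n => stoppingValue P f n x := by
  refine monotone_nat_of_le_succ fun n => ?_
  induction n generalizing x with
  | zero => exact le_max_right _ _
  | succ n ih =>
    exact max_le_max (add_le_add le_rfl
      (transition_mono P (hf.stoppingValue n) (hf.stoppingValue (n + 1)) ih x)) le_rfl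

lemma stoppingValue_nonneg (hf : BddMeasurable f) (n : ℕ) (x : X) : 0 ≤ stoppingValue P f n x :=
  stoppingValue_mono hf x n.zero_le

lemma potential_le_stoppingValue (hf : BddMeasurable f) (n : ℕ) (x : X) :
    potential P f n x ≤ stoppingValue P f n x := by
  induction n generalizing x with
  | zero => exact (birkhoffSum_zero _ _ _).le
  | succ n ih =>
    rw [potential_succ P hf]
    exact (add_le_add le_rfl
      (transition_mono P (hf.potential P n) (hf.stoppingValue n) ih x)).trans (le_max_left _ _)

lemma stoppingValue_succ_le (hf : BddMeasurable f) (n : ℕ) (x : X) :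
    stoppingValue P f (n + 1) x ≤ {y | 0 < stoppingValue P f (n + 1) y}.indicator f x +
      transition P (stoppingValue P f n) x := by
  by_cases hx : 0 < stoppingValue P f (n + 1) x
  · rw [Set.indicator_of_mem (by exact hx)]
    exact max_le le_rfl ((lt_max_iff.1 hx).resolve_right (lt_irrefl 0)).le
  · rw [Set.indicator_of_notMem (by exact hx), zero_add]
    exact (not_lt.1 hx).trans (integral_nonneg fun y => stoppingValue_nonneg hf n y)

lemma measurableSet_stoppingValue_pos (hf : BddMeasurable f) (n : ℕ) :
    MeasurableSet {x | 0 < stoppingValue P f n x} :=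
  measurableSet_lt measurable_const (hf.stoppingValue n).measurable

lemma maximal_ergodic_inequality {π : Measure X} [IsFiniteMeasure π] (hπ : P.Invariant π)
    (hf : BddMeasurable f) (n : ℕ) : 0 ≤ ∫ x in {x | 0 < stoppingValue P f n x}, f x ∂π := by
  cases n with
  | zero => simp [stoppingValue]
  | succ n =>
    have hpos := measurableSet_stoppingValue_pos (P := P) hf (n + 1)
    have hrec := integral_mono ((hf.stoppingValue (n + 1)).integrable π)
      (((hf.indicator hpos).add ((hf.stoppingValue n).transition P)).integrable π)
      (stoppingValue_succ_le hf n)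
    rw [integral_add ((hf.indicator hpos).integrable π)
      (((hf.stoppingValue n).transition P).integrable π), integral_indicator hpos,
      integral_transition_of_invariant P (hf.stoppingValue n) hπ] at hrec
    have hmono := integral_mono ((hf.stoppingValue (P := P) n).integrable π)
      ((hf.stoppingValue (n + 1)).integrable π) fun x => stoppingValue_mono hf x n.le_succ
    linarith

lemma integral_nonneg_of_exists_stoppingValue_pos {π : Measure X} [IsFiniteMeasure π]
    (hπ : P.Invariant π) (hf : BddMeasurable f) (hpos : ∀ x, ∃ n, 0 < stoppingValue P f n x) :
    0 ≤ ∫ x, f x ∂π := by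
  have hmono : Monotone fun n => {x | 0 < stoppingValue P f n x} :=
    fun m n hmn x hx => lt_of_lt_of_le hx (stoppingValue_mono (P := P) hf x hmn)
  have hlim := tendsto_setIntegral_of_monotone (measurableSet_stoppingValue_pos (P := P) hf) hmono
    (hf.integrable π).integrableOn
  have hunion : ⋃ n, {x | 0 < stoppingValue P f n x} = Set.univ := Set.iUnion_eq_univ_iff.2 hpos
  rw [hunion, setIntegral_univ] at hlim
  exact ge_of_tendsto' hlim fun n => maximal_ergodic_inequality hπ hf n

/-- The states from which the optimal stopping problem with reward `f` has finite value over an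
infinite horizon. -/
def finiteValueSet (P : Kernel X X) (f : X → ℝ) : Set X :=
  {x | BddAbove (Set.range fun n => stoppingValue P f n x)}

lemma measurableSet_finiteValueSet (hf : BddMeasurable f) :
    MeasurableSet (finiteValueSet P f) :=
  measurableSet_bddAbove_range fun n => (hf.stoppingValue n).measurable

lemma finiteValueSet_nonempty {π : Measure X} [IsFiniteMeasure π] (hπ : P.Invariant π)
    (hf : BddMeasurable f) (hneg : ∫ x, f x ∂π < 0) : (finiteValueSet P f).Nonempty := by
  by_contra! hempty
  refine hneg.not_ge (integral_nonneg_of_exists_stoppingValue_pos hπ hf fun x => ?_)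
  obtain ⟨_, ⟨n, rfl⟩, hn⟩ := not_bddAbove_iff.1 (Set.eq_empty_iff_forall_notMem.1 hempty x) 0
  exact ⟨n, hn⟩

lemma ae_bddAbove_of_monotone_of_integral_le {μ : Measure E} {v : ℕ → E → ℝ}
    (hint : ∀ n, Integrable (v n) μ) (hnonneg : ∀ n y, 0 ≤ v n y)
    (hmono : ∀ y, Monotone fun n => v n y) {M : ℝ} (hM : ∀ n, ∫ y, v n y ∂μ ≤ M) :
    ∀ᵐ y ∂μ, BddAbove (Set.range fun n => v n y) := by
  have hmeas : ∀ n, AEMeasurable (fun y => ENNReal.ofReal (v n y)) μ := fun n =>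
    (hint n).aemeasurable.ennreal_ofReal
  have hfin : ∫⁻ y, ⨆ n, ENNReal.ofReal (v n y) ∂μ ≠ ⊤ := by
    rw [lintegral_iSup' hmeas (ae_of_all _ fun y m n hmn => ENNReal.ofReal_le_ofReal (hmono y hmn))]
    refine ne_top_of_le_ne_top (ENNReal.ofReal_ne_top (r := M)) (iSup_le fun n => ?_)
    rw [← ofReal_integral_eq_lintegral_ofReal (hint n) (ae_of_all _ (hnonneg n))]
    exact ENNReal.ofReal_le_ofReal (hM n)
  filter_upwards [ae_lt_top' (.iSup hmeas) hfin] with y hy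
  refine ⟨(⨆ n, ENNReal.ofReal (v n y)).toReal, ?_⟩
  rintro _ ⟨n, rfl⟩
  exact (ENNReal.ofReal_le_iff_le_toReal hy.ne).1 (le_iSup (fun n => ENNReal.ofReal (v n y)) n)

lemma isAbsorbing_finiteValueSet (hf : BddMeasurable f) :
    IsAbsorbing P (finiteValueSet P f) := by
  rintro x ⟨M, hM⟩
  refine ae_bddAbove_of_monotone_of_integral_le (fun n => (hf.stoppingValue n).integrable _)
    (stoppingValue_nonneg hf) (stoppingValue_mono hf) (M := M - f x) fun n => ?_
  have hle : f x + transition P (stoppingValue P f n) x ≤ M :=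
    (le_max_left _ _).trans (hM ⟨n + 1, rfl⟩)
  exact le_sub_iff_add_le'.2 hle

lemma tendsto_cesaro_posPart_of_mem_finiteValueSet (hf : BddMeasurable f) {x : X}
    (hx : x ∈ finiteValueSet P f) : Tendsto (fun n => cesaro P f n x ⊔ 0) atTop (𝓝 0) := by
  obtain ⟨M, hM⟩ := hx
  refine squeeze_zero (fun _ => le_max_right _ _) (fun n => ?_)
    (tendsto_const_div_atTop_nhds_zero_nat M)
  have hbound := hM ⟨n, rfl⟩
  refine max_le ?_ (div_nonneg ((stoppingValue_nonneg hf n x).trans hbound) n.cast_nonneg)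
  rw [cesaro_eq_inv_mul_potential, div_eq_inv_mul]
  gcongr
  exact (potential_le_stoppingValue hf n x).trans hbound

lemma tendsto_iterate_transition_indicator_compl {x : X} (hAm : MeasurableSet A)
    (hev : ∀ᵐ ω ∂(chainLaw P x), ∀ᶠ t in atTop, ω t ∈ A) (a : ℝ) :
    Tendsto (fun t => (transition P)^[t] (Aᶜ.indicator fun _ => a) x) atTop (𝓝 0) := by
  have hind := (BddMeasurable.const (E := X) a).indicator hAm.compl
  simp only [← integral_chainLaw P x _ hind]
  rw [← integral_zero (ℕ → X) ℝ (μ := chainLaw P x)]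
  refine tendsto_integral_of_dominated_convergence (fun _ => |a|)
    (fun t => (hind.comp (measurable_pi_apply t)).measurable.aestronglyMeasurable)
    (integrable_const _) (fun t => ae_of_all _ fun ω => norm_indicator_le_norm_self _ (ω t)) ?_
  filter_upwards [hev] with ω hω
  refine tendsto_const_nhds.congr' ?_
  filter_upwards [hω] with t ht
  exact (Set.indicator_of_notMem (not_not.2 ht) _).symm

lemma tendsto_iterate_transition_zero {F : ℕ → X → ℝ} (hF : ∀ n, BddMeasurable (F n)) {C : ℝ}
    (hC : ∀ n y, |F n y| ≤ C) (hlim : ∀ y, Tendsto (fun n => F n y) atTop (𝓝 0)) (t : ℕ) (x : X) :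
    Tendsto (fun n => (transition P)^[t] (F n) x) atTop (𝓝 0) := by
  simp only [← integral_chainLaw P x _ (hF _)]
  rw [← integral_zero (ℕ → X) ℝ (μ := chainLaw P x)]
  exact tendsto_integral_of_dominated_convergence (fun _ => C)
    (fun n => ((hF n).comp (measurable_pi_apply t)).measurable.aestronglyMeasurable)
    (integrable_const _) (fun n => ae_of_all _ fun ω => hC n _) (ae_of_all _ fun ω => hlim _)

lemma iterate_transition_le_add {g h k : X → ℝ} (hg : BddMeasurable g) (hh : BddMeasurable h)
    (hk : BddMeasurable k) (hle : ∀ y, g y ≤ h y + k y) (t : ℕ) (x : X) :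
    (transition P)^[t] g x ≤ (transition P)^[t] h x + (transition P)^[t] k x := by
  have heval := measurable_pi_apply (X := fun _ : ℕ => X) t
  rw [← integral_chainLaw P x t hg, ← integral_chainLaw P x t hh, ← integral_chainLaw P x t hk,
    ← integral_add ((hh.comp heval).integrable _) ((hk.comp heval).integrable _)]
  exact integral_mono ((hg.comp heval).integrable _) (((hh.add hk).comp heval).integrable _)
    fun ω => hle (ω t)

/-- Far in time the chain sits in `A`, where the averages have no positive part in the limit, while
`cesaro_n f (x)` and the expectation of `cesaro_n f` at a fixed later time differ by `o(1)`. -/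
lemma eventually_cesaro_lt_of_ae_eventually_mem (hf : BddMeasurable f) (hAm : MeasurableSet A)
    (hlim : ∀ y ∈ A, Tendsto (fun n => cesaro P f n y ⊔ 0) atTop (𝓝 0)) {x : X}
    (hev : ∀ᵐ ω ∂(chainLaw P x), ∀ᶠ t in atTop, ω t ∈ A) {ε : ℝ} (hε : 0 < ε) :
    ∀ᶠ n in atTop, cesaro P f n x < ε := by
  obtain ⟨C, hC⟩ := hf.bounded
  have hpos : ∀ n, BddMeasurable (fun y => cesaro P f n y ⊔ 0) :=
    fun n => (hf.cesaro P n).sup (.const 0)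
  have hposC : ∀ n y, |cesaro P f n y ⊔ 0| ≤ C := fun n y =>
    (abs_max_le_max_abs_abs).trans
      (max_le (abs_cesaro_le P hC n y) (by simpa using (abs_nonneg _).trans (hC y)))
  obtain ⟨t, ht⟩ := ((tendsto_iterate_transition_indicator_compl hAm hev C).eventually_lt_const
    (by positivity : 0 < ε / 3)).exists
  have hin : Tendsto (fun n => (transition P)^[t] (A.indicator fun y => cesaro P f n y ⊔ 0) x)
      atTop (𝓝 0) := by
    have hinC : ∀ n y, |A.indicator (fun y => cesaro P f n y ⊔ 0) y| ≤ C := fun n y =>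
      (norm_indicator_le_norm_self (fun y => cesaro P f n y ⊔ 0) y).trans (hposC n y)
    refine tendsto_iterate_transition_zero (fun n => (hpos n).indicator hAm) hinC (fun y => ?_) t x
    by_cases hy : y ∈ A
    · simpa only [Set.indicator_of_mem hy] using hlim y hy
    · simp only [Set.indicator_of_notMem hy, tendsto_const_nhds]
  filter_upwards [hin.eventually_lt_const (by positivity : 0 < ε / 3),
    (tendsto_iterate_transition_cesaro_sub P hf t x).eventually_const_lt
      (by linarith : -(ε / 3) < 0)] with n hn hshift
  have hsplit := iterate_transition_le_add (P := P) (hf.cesaro P n) ((hpos n).indicator hAm)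
    ((BddMeasurable.const C).indicator hAm.compl) (fun y => ?_) t x
  · linarith
  · by_cases hy : y ∈ A
    · simp [hy]
    · simpa [hy] using (abs_le.1 (abs_cesaro_le P hC n y)).2

lemma IsHarrisRecurrent.eventually_cesaro_lt (hP : IsHarrisRecurrent P) {π : Measure X}
    [IsProbabilityMeasure π] (hπ : P.Invariant π) (hf : BddMeasurable f) {a : ℝ}
    (ha : ∫ x, f x ∂π < a) (x : X) : ∀ᶠ n in atTop, cesaro P f n x < a := by
  obtain ⟨b, hb, hba⟩ := exists_between ha
  have hfb := hf.sub_const b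
  have hneg : ∫ x, f x - b ∂π < 0 := by
    rw [integral_sub (hf.integrable π) (integrable_const b)]
    simpa using hb
  have hev := hP.ae_eventually_mem (isAbsorbing_finiteValueSet hfb)
    (measurableSet_finiteValueSet hfb) (finiteValueSet_nonempty hπ hfb hneg) x
  filter_upwards [eventually_cesaro_lt_of_ae_eventually_mem hfb (measurableSet_finiteValueSet hfb)
    (fun y => tendsto_cesaro_posPart_of_mem_finiteValueSet hfb) hev (sub_pos.2 hba),
    eventually_ne_atTop 0] with n hn hn0
  rw [cesaro_sub_const P hf b hn0] at hn
  exact (sub_lt_sub_iff_right b).1 hn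

theorem IsHarrisRecurrent.tendsto_cesaro (hP : IsHarrisRecurrent P) {π : Measure X}
    [IsProbabilityMeasure π] (hπ : P.Invariant π) (hf : BddMeasurable f) (x : X) :
    Tendsto (fun n => cesaro P f n x) atTop (𝓝 (∫ x, f x ∂π)) := by
  refine tendsto_order.2 ⟨fun a ha => ?_, fun a ha => hP.eventually_cesaro_lt hπ hf ha x⟩
  have hneg : ∫ x, -f x ∂π < -a := by simpa only [integral_neg] using neg_lt_neg ha
  simpa only [cesaro_neg, neg_lt_neg_iff] using hP.eventually_cesaro_lt hπ hf.neg hneg x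

lemma IsHarrisRecurrent.invariant_unique (hP : IsHarrisRecurrent P) {π π' : Measure X}
    [IsProbabilityMeasure π] [IsProbabilityMeasure π'] (hπ : P.Invariant π)
    (hπ' : P.Invariant π') : π = π' := by
  obtain ⟨x⟩ := nonempty_of_isProbabilityMeasure π
  ext A hA
  have hind := (BddMeasurable.const (E := X) 1).indicator hA
  have heq := tendsto_nhds_unique (hP.tendsto_cesaro hπ hind x) (hP.tendsto_cesaro hπ' hind x)
  rw [integral_indicator_const _ hA, integral_indicator_const _ hA, smul_eq_mul, smul_eq_mul,
    mul_one, mul_one] at heq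
  exact (measureReal_eq_measureReal_iff).1 heq

end Harris

/-! ### The average cost of a stationary policy -/

section Cost

variable {U : Type*} [MeasurableSpace U] (T : Kernel (X × U) X) [IsMarkovKernel T]

instance (γ : AdmissiblePolicy X U) (x : X) : IsProbabilityMeasure (processLaw T γ x) := by
  unfold processLaw; infer_instance

lemma transition_stepKernel (γ : StationaryPolicy X U) (t : ℕ) {g : X × U → ℝ}
    (hg : BddMeasurable g) (h : Finset.Iic t → X × U) :
    transition (stepKernel T γ.toAdmissible t) g h =
      transition T (fun x => g (x, γ.1 x)) (h ⟨t, Finset.mem_Iic.2 le_rfl⟩) := by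
  have hstate : Measurable fun p : (Finset.Iic t → X × U) × X =>
      (p.2, γ.toAdmissible.step t p) :=
    measurable_snd.prodMk (γ.toAdmissible.measurable_step t)
  have hcost := hg.comp hstate
  rw [transition, stepKernel, Kernel.map_apply _ hstate, integral_map hstate.aemeasurable
    hg.measurable.aestronglyMeasurable, Kernel.prod_apply, Kernel.id_apply, Kernel.comap_apply,
    integral_prod _ (hcost.integrable _), integral_dirac' _ _
    hcost.measurable.stronglyMeasurable.integral_prod_right]
  rfl

lemma integral_processLaw (γ : StationaryPolicy X U) (x : X) (t : ℕ) {g : X × U → ℝ}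
    (hg : BddMeasurable g) :
    ∫ ω, g (ω t) ∂(processLaw T γ.toAdmissible x) =
      (transition (closedLoop T γ))^[t] (fun y => g (y, γ.1 y)) x := by
  induction t generalizing g with
  | zero => exact integral_traj_zero _ _ hg
  | succ t ih =>
    have hstep : ∫ ω, g (ω (t + 1)) ∂(processLaw T γ.toAdmissible x) =
        ∫ ω, transition T (fun y => g (y, γ.1 y)) (ω t) ∂(processLaw T γ.toAdmissible x) :=
      (integral_traj_succ _ _ t hg).trans
        (integral_congr_ae (ae_of_all _ fun _ => transition_stepKernel T γ t hg _))
    rw [hstep, ih ((hg.comp (φ := fun y => (y, γ.1 y)) (measurable_id.prodMk γ.2)).transition T),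
      Function.iterate_succ_apply]
    rfl

lemma average_processLaw (γ : StationaryPolicy X U) (x : X) {g : X × U → ℝ}
    (hg : BddMeasurable g) (N : ℕ) :
    1 / (N : ℝ) * ∫ ω, ∑ t ∈ Finset.range N, g (ω t) ∂(processLaw T γ.toAdmissible x) =
      cesaro (closedLoop T γ) (fun y => g (y, γ.1 y)) N x := by
  rw [integral_finsetSum _ fun t _ => (hg.comp (measurable_pi_apply t)).integrable _, one_div,
    cesaro_eq_inv_mul_potential]
  simp only [integral_processLaw T γ x _ hg]
  rfl

lemma avgCost_eq_integral (γ : StationaryPolicy X U) (hγ : IsHarrisRecurrent (closedLoop T γ))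
    {π : Measure X} [IsProbabilityMeasure π] (hπ : (closedLoop T γ).Invariant π)
    {c : X × U → ℝ} (hc : BddMeasurable c) (x : X) :
    avgCost T c x γ.toAdmissible = ∫ y, c (y, γ.1 y) ∂π := by
  simp only [avgCost, average_processLaw T γ x hc]
  exact (hγ.tendsto_cesaro hπ (hc.comp (measurable_id.prodMk γ.2)) x).limsup_eq

lemma abs_average_processLaw_le {c : X × U → ℝ} {C : ℝ} (hC : ∀ p, |c p| ≤ C) (x : X)
    (γ : AdmissiblePolicy X U) (N : ℕ) :
    |1 / (N : ℝ) * ∫ ω, ∑ t ∈ Finset.range N, c (ω t) ∂(processLaw T γ x)| ≤ C := by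
  refine abs_one_div_mul_le ((abs_nonneg _).trans (hC (x, γ.init x))) ?_
  simpa using norm_integral_le_of_norm_le_const (μ := processLaw T γ x)
    (f := fun ω => ∑ t ∈ Finset.range N, c (ω t))
    (ae_of_all _ fun ω => abs_sum_range_le fun t => hC (ω t))

lemma neg_le_avgCost {c : X × U → ℝ} {C : ℝ} (hC : ∀ p, |c p| ≤ C) (x : X)
    (γ : AdmissiblePolicy X U) : -C ≤ avgCost T c x γ := by
  have hbound := fun N => abs_le.1 (abs_average_processLaw_le T hC x γ N)
  exact le_limsup_of_frequently_le (Frequently.of_forall fun N => (hbound N).1)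
    (isBoundedUnder_of ⟨C, fun N => (hbound N).2⟩)

lemma optCost_le_avgCost {c : X × U → ℝ} {C : ℝ} (hC : ∀ p, |c p| ≤ C) (x : X)
    {Γ : Set (AdmissiblePolicy X U)} {γ : AdmissiblePolicy X U} (hγ : γ ∈ Γ) :
    optCost T c x Γ ≤ avgCost T c x γ :=
  ciInf_le ⟨-C, Set.forall_mem_range.2 fun γ : Γ => neg_le_avgCost T hC x γ⟩ (⟨γ, hγ⟩ : Γ)

end Cost

/-! ### Continuous convergence -/

/-- Continuous convergence of a family of functions: `F i y'` tends to `f y` as `i` tends along `l`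
and `y'` tends to `y`, jointly. For sequences on a first countable space this is the convergence
`F n (q n) → f y` whenever `q n → y`. -/
def TendstoContinuously {ι α β : Type*} [TopologicalSpace α] [TopologicalSpace β]
    (F : ι → α → β) (f : α → β) (l : Filter ι) : Prop :=
  ∀ y, Tendsto (fun p : ι × α => F p.1 p.2) (l ×ˢ 𝓝 y) (𝓝 (f y))

lemma tendsto_extend_of_strictMono {α : Type*} [TopologicalSpace α] {ψ : ℕ → ℕ}
    (hψ : StrictMono ψ) {w : ℕ → α} {y : α} (hw : Tendsto w atTop (𝓝 y)) :
    Tendsto (Function.extend ψ w fun _ => y) atTop (𝓝 y) := by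
  refine tendsto_def.2 fun V hV => ?_
  obtain ⟨k, hk⟩ := eventually_atTop.1 (hw.eventually_mem hV)
  filter_upwards [eventually_ge_atTop (ψ k)] with n hn
  by_cases hex : ∃ j, ψ j = n
  · obtain ⟨j, rfl⟩ := hex
    rw [Set.mem_preimage, hψ.injective.extend_apply]
    exact hk j (hψ.le_iff_le.1 hn)
  · rw [Set.mem_preimage, Function.extend_apply' _ _ _ hex]
    exact mem_of_mem_nhds hV

namespace TendstoContinuously

variable {ι α β δ : Type*} [TopologicalSpace α] [TopologicalSpace β] [TopologicalSpace δ]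
  {l : Filter ι} {F : ι → α → β} {f : α → β}

lemma mono (h : TendstoContinuously F f l) {l' : Filter ι} (hl : l' ≤ l) :
    TendstoContinuously F f l' :=
  fun y => (h y).mono_left (prod_mono_left (𝓝 y) hl)

lemma tendsto (h : TendstoContinuously F f l) (y : α) : Tendsto (fun i => F i y) l (𝓝 (f y)) :=
  (h y).comp (tendsto_id.prodMk tendsto_const_nhds)

lemma const (hf : Continuous f) : TendstoContinuously (fun _ : ι => f) f l :=
  fun y => (hf.tendsto y).comp tendsto_snd

lemma comp {G : ι → β → δ} {g : β → δ} (hG : TendstoContinuously G g l)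
    (hF : TendstoContinuously F f l) :
    TendstoContinuously (fun i y => G i (F i y)) (fun y => g (f y)) l :=
  fun y => (hG (f y)).comp (tendsto_fst.prodMk (hF y))

lemma id_prodMk (h : TendstoContinuously F f l) :
    TendstoContinuously (fun i y => (y, F i y)) (fun y => (y, f y)) l :=
  fun y => tendsto_snd.prodMk_nhds (h y)

lemma continuous [NeBot l] [RegularSpace β] (h : TendstoContinuously F f l) : Continuous f := by
  refine continuous_iff_continuousAt.2 fun y =>
    (closed_nhds_basis (f y)).tendsto_right_iff.2 fun V hV => ?_
  filter_upwards [(eventually_swap_iff.1 ((h y).eventually_mem hV.1)).curry] with z hz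
  exact hV.2.mem_of_tendsto (h.tendsto z) hz

lemma of_seq [FirstCountableTopology α] {F : ℕ → α → β}
    (h : ∀ (y : α) (q : ℕ → α), Tendsto q atTop (𝓝 y) →
      Tendsto (fun n => F n (q n)) atTop (𝓝 (f y))) :
    TendstoContinuously F f atTop := by
  refine fun y => tendsto_of_subseq_tendsto fun p hp => ?_
  obtain ⟨φ, hφ, hmono⟩ := strictMono_subseq_of_tendsto_atTop (tendsto_fst.comp hp)
  have hq := tendsto_extend_of_strictMono hmono
    ((tendsto_snd.comp hp).comp hφ.tendsto_atTop)
  refine ⟨φ, ((h y _ hq).comp hmono.tendsto_atTop).congr fun k => ?_⟩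
  exact congrArg _ (hmono.injective.extend_apply _ _ k)

lemma of_equicontinuous {γ : Type*} [UniformSpace γ] {F : ι → α → γ} {f : α → γ}
    (hF : Equicontinuous F) (h : ∀ y, Tendsto (fun i => F i y) l (𝓝 (f y))) :
    TendstoContinuously F f l := by
  intro y
  rw [Uniform.tendsto_nhds_right]
  intro V hV
  obtain ⟨W, hW, hWV⟩ := comp_mem_uniformity_sets hV
  have hat : ∀ᶠ i in l, (f y, F i y) ∈ W := Uniform.tendsto_nhds_right.1 (h y) hW
  refine (hat.prod_mk (hF y W hW)).mono fun p hp => ?_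
  exact hWV ⟨F p.1 y, hp.1, hp.2 p.1⟩

lemma tendstoUniformlyOn {γ : Type*} [UniformSpace γ] {F : ι → α → γ} {f : α → γ} [NeBot l]
    (h : TendstoContinuously F f l) {K : Set α} (hK : IsCompact K) :
    TendstoUniformlyOn F f l K := by
  rw [← tendstoLocallyUniformlyOn_iff_tendstoUniformlyOn_of_compact hK,
    tendstoLocallyUniformlyOn_iff_forall_tendsto]
  intro y _
  have hfy : Tendsto (fun p : ι × α => f p.2) (l ×ˢ 𝓝 y) (𝓝 (f y)) :=
    (h.continuous.tendsto y).comp tendsto_snd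
  exact ((hfy.prodMk_nhds (h y)).mono_left (prod_mono_right _ nhdsWithin_le_nhds)).mono_right
    (nhds_le_uniformity _)

end TendstoContinuously

lemma exists_tendstoContinuously_of_equicontinuous {ι α γ : Type*} [TopologicalSpace α]
    [UniformSpace γ] [CompactSpace γ] (l : Ultrafilter ι) {F : ι → α → γ}
    (hF : Equicontinuous F) : ∃ f, TendstoContinuously F f l := by
  have hlim : ∀ y, ∃ z, Tendsto (fun i => F i y) l (𝓝 z) := fun y =>
    ⟨_, (l.map fun i => F i y).le_nhds_lim⟩
  choose f hf using hlim
  exact ⟨f, .of_equicontinuous hF hf⟩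

/-! ### Stability of invariant measures -/

section Stability

variable {ι : Type*} {l : Filter ι}

lemma norm_integral_le_of_norm_le_of_norm_le_compl {μ : Measure E} [IsFiniteMeasure μ] {g : E → ℝ}
    {K : Set E} (hK : MeasurableSet K) {a b : ℝ} (ha : ∀ x ∈ K, ‖g x‖ ≤ a)
    (hb : ∀ x ∈ Kᶜ, ‖g x‖ ≤ b) : ‖∫ x, g x ∂μ‖ ≤ μ.real K * a + μ.real Kᶜ * b := by
  have hintK : Integrable (K.indicator fun _ => a) μ := (integrable_const a).indicator hK
  have hintKc : Integrable (Kᶜ.indicator fun _ => b) μ := (integrable_const b).indicator hK.compl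
  refine (norm_integral_le_of_norm_le (hintK.add hintKc) (ae_of_all _ fun x => ?_)).trans_eq ?_
  · by_cases hx : x ∈ K
    · simpa [hx] using ha x hx
    · simpa [hx] using hb x hx
  · rw [integral_add' hintK hintKc, integral_indicator_const _ hK,
      integral_indicator_const _ hK.compl, smul_eq_mul, smul_eq_mul]

variable [TopologicalSpace X]

lemma tendsto_integral_zero_of_isTightMeasureSet [T2Space X] [OpensMeasurableSpace X]
    {μs : ι → Measure X} [∀ i, IsProbabilityMeasure (μs i)]
    (hμs : IsTightMeasureSet (Set.range μs)) {g : ι → X → ℝ} {C : ℝ} (hC : ∀ i x, ‖g i x‖ ≤ C)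
    (hg : ∀ K, IsCompact K → TendstoUniformlyOn g 0 l K) :
    Tendsto (fun i => ∫ x, g i x ∂μs i) l (𝓝 0) := by
  refine Metric.tendsto_nhds.2 fun ε hε => ?_
  obtain ⟨δ, hδ, hδC⟩ := exists_pos_mul_lt (half_pos hε) C
  obtain ⟨K, hK, hKμ⟩ := isTightMeasureSet_iff_exists_isCompact_measure_compl_le.1 hμs
    (ENNReal.ofReal δ) (ENNReal.ofReal_pos.2 hδ)
  filter_upwards [Metric.tendstoUniformlyOn_iff.1 (hg K hK) (ε / 2) (by positivity)] with i hi
  have hin : ∀ x ∈ K, ‖g i x‖ ≤ ε / 2 := fun x hx => by simpa using (hi x hx).le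
  have hmass : (μs i).real Kᶜ ≤ δ := ENNReal.toReal_le_of_le_ofReal hδ.le (hKμ _ ⟨i, rfl⟩)
  obtain ⟨x⟩ := nonempty_of_isProbabilityMeasure (μs i)
  have hC0 : 0 ≤ C := (norm_nonneg _).trans (hC i x)
  rw [dist_zero_right]
  calc ‖∫ x, g i x ∂μs i‖ ≤ (μs i).real K * (ε / 2) + (μs i).real Kᶜ * C :=
        norm_integral_le_of_norm_le_of_norm_le_compl hK.measurableSet hin fun x _ => hC i x
    _ ≤ 1 * (ε / 2) + δ * C := by gcongr; exact measureReal_le_one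
    _ < ε := by linarith

lemma continuous_kernelAt_of_tendstoContinuously {α : Type*} [MeasurableSpace α]
    [TopologicalSpace α] [OpensMeasurableSpace X] {Ts : ι → Kernel α X}
    [∀ i, IsMarkovKernel (Ts i)] {T : Kernel α X}
    [IsMarkovKernel T] [NeBot l]
    (hT : TendstoContinuously (fun i => kernelAt (Ts i)) (kernelAt T) l) :
    Continuous (kernelAt T) := by
  refine ProbabilityMeasure.continuous_iff_forall_continuous_integral.2 fun f => ?_
  exact TendstoContinuously.continuous (l := l) (F := fun i y => ∫ x, f x ∂Ts i y) fun y =>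
    ProbabilityMeasure.tendsto_iff_forall_integral_tendsto.1 (hT y) f

variable [T2Space X] [BorelSpace X]

lemma TendstoContinuously.tendsto_integral [NeBot l] {μs : ι → ProbabilityMeasure X}
    {μ : ProbabilityMeasure X} (hμ : Tendsto μs l (𝓝 μ))
    (htight : IsTightMeasureSet (Set.range fun i => (μs i : Measure X))) {F : ι → X → ℝ}
    {f : X → ℝ} (hF : TendstoContinuously F f l) (hFm : ∀ i, Measurable (F i)) {C : ℝ}
    (hC : ∀ i x, |F i x| ≤ C) :
    Tendsto (fun i => ∫ x, F i x ∂(μs i : Measure X)) l (𝓝 (∫ x, f x ∂(μ : Measure X))) := by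
  have hfC : ∀ x, |f x| ≤ C := fun x => le_of_tendsto' (hF.tendsto x).abs fun i => hC i x
  have hlimit : Tendsto (fun i => ∫ x, f x ∂(μs i : Measure X)) l (𝓝 (∫ x, f x ∂(μ : Measure X))) :=
    ProbabilityMeasure.tendsto_iff_forall_integral_tendsto.1 hμ
      (BoundedContinuousFunction.ofNormedAddCommGroup f hF.continuous C hfC)
  have herror : Tendsto (fun i => ∫ x, F i x - f x ∂(μs i : Measure X)) l (𝓝 0) := by
    refine tendsto_integral_zero_of_isTightMeasureSet htight
      (fun i x => (abs_sub _ _).trans (add_le_add (hC i x) (hfC x))) fun K hK => ?_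
    simpa [Metric.tendstoUniformlyOn_iff, Real.dist_eq, abs_sub_comm]
      using hF.tendstoUniformlyOn hK
  rw [← zero_add (∫ x, f x ∂(μ : Measure X))]
  refine (herror.add hlimit).congr fun i => ?_
  have hFi : BddMeasurable (F i) := ⟨hFm i, C, hC i⟩
  have hf : BddMeasurable f := ⟨hF.continuous.measurable, C, hfC⟩
  rw [integral_sub (hFi.integrable _) (hf.integrable _), sub_add_cancel]

variable {Ps : ι → Kernel X X} [∀ i, IsMarkovKernel (Ps i)] {P : Kernel X X} [IsMarkovKernel P]

lemma invariant_of_tendstoContinuously [HasOuterApproxClosed X] [NeBot l]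
    (hP : TendstoContinuously (fun i => kernelAt (Ps i)) (kernelAt P) l)
    {πs : ι → ProbabilityMeasure X} (hπs : ∀ i, (Ps i).Invariant (πs i : Measure X))
    (htight : IsTightMeasureSet (Set.range fun i => (πs i : Measure X)))
    {π : ProbabilityMeasure X} (hπ : Tendsto πs l (𝓝 π)) : P.Invariant (π : Measure X) := by
  refine ext_of_forall_integral_eq_of_IsFiniteMeasure fun f => ?_
  have hf : BddMeasurable f := ⟨f.continuous.measurable, ‖f‖, f.norm_coe_le_norm⟩
  have htrans : TendstoContinuously (fun i => transition (Ps i) f) (transition P f) l := fun x =>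
    ProbabilityMeasure.tendsto_iff_forall_integral_tendsto.1 (hP x) f
  have hlim := htrans.tendsto_integral hπ htight (fun i => (hf.transition (Ps i)).measurable)
    fun i => abs_transition_le (Ps i) f.norm_coe_le_norm
  simp only [integral_transition_of_invariant _ hf (hπs _)] at hlim
  rw [← integral_transition P hf]
  exact tendsto_nhds_unique hlim
    (ProbabilityMeasure.tendsto_iff_forall_integral_tendsto.1 hπ f)

lemma tendsto_invariant [HasOuterApproxClosed X]
    (hP : TendstoContinuously (fun i => kernelAt (Ps i)) (kernelAt P) l)
    {πs : ι → ProbabilityMeasure X} (hπs : ∀ i, (Ps i).Invariant (πs i : Measure X))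
    (htight : IsTightMeasureSet (Set.range fun i => (πs i : Measure X)))
    {π : ProbabilityMeasure X}
    (hunique : ∀ ν : ProbabilityMeasure X, P.Invariant (ν : Measure X) → ν = π) :
    Tendsto πs l (𝓝 π) := by
  have hcompact : IsCompact (closure (Set.range πs)) := by
    refine isCompact_closure_of_isTightMeasureSet (htight.subset ?_)
    rintro _ ⟨_, ⟨i, rfl⟩, rfl⟩
    exact ⟨i, rfl⟩
  refine hcompact.tendsto_nhds_of_unique_mapClusterPt
    (Eventually.of_forall fun i => subset_closure ⟨i, rfl⟩) fun ν _ hν => hunique ν ?_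
  obtain ⟨l', hl', hlim⟩ := mapClusterPt_iff_ultrafilter.1 hν
  exact invariant_of_tendstoContinuously (hP.mono hl') hπs htight hlim

end Stability

/-! ### Stability of the average cost -/

section Robustness

variable {P : Kernel X X} [IsMarkovKernel P]

lemma IsPositiveHarris.isHarrisRecurrent (hP : IsPositiveHarris P) : IsHarrisRecurrent P := hP.1

lemma IsPositiveHarris.exists_invariant (hP : IsPositiveHarris P) :
    ∃ π : ProbabilityMeasure X, P.Invariant (π : Measure X) :=
  let ⟨π, hπ, hinv⟩ := hP.2
  ⟨⟨π, hπ⟩, hinv⟩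

variable {U : Type*} [MeasurableSpace U] {ι : Type*} {l : Filter ι} [NeBot l]
  {Ts : ι → Kernel (X × U) X} [∀ i, IsMarkovKernel (Ts i)] {T : Kernel (X × U) X}
  [IsMarkovKernel T]

lemma avgCost_eq_optCost_of_tendsto {c : X × U → ℝ} {C : ℝ} (hC : ∀ p, |c p| ≤ C) {x₀ : X}
    {Γ : Set (AdmissiblePolicy X U)} {γs : ι → AdmissiblePolicy X U} {γ γopt : AdmissiblePolicy X U}
    (hγ : γ ∈ Γ) (hγopt : γopt ∈ Γ) (hopt : avgCost T c x₀ γopt = optCost T c x₀ Γ)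
    (hopts : ∀ i, avgCost (Ts i) c x₀ (γs i) = optCost (Ts i) c x₀ Γ)
    (hlim : Tendsto (fun i => avgCost (Ts i) c x₀ (γs i)) l (𝓝 (avgCost T c x₀ γ)))
    (hcompetitor : Tendsto (fun i => avgCost (Ts i) c x₀ γopt) l (𝓝 (avgCost T c x₀ γopt))) :
    avgCost T c x₀ γ = optCost T c x₀ Γ := by
  refine le_antisymm ?_ (optCost_le_avgCost T hC x₀ hγ)
  rw [← hopt]
  exact le_of_tendsto_of_tendsto' hlim hcompetitor fun i =>
    (hopts i).trans_le (optCost_le_avgCost (Ts i) hC x₀ hγopt)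

theorem tendsto_avgCost [TopologicalSpace X] [T2Space X] [BorelSpace X] [HasOuterApproxClosed X]
    [TopologicalSpace U] [OpensMeasurableSpace (X × U)]
    (hTs : TendstoContinuously (fun i => kernelAt (Ts i)) (kernelAt T) l)
    {γs : ι → StationaryPolicy X U} {γ : StationaryPolicy X U}
    (hγs : TendstoContinuously (fun i => (γs i).1) γ.1 l)
    (hHarriss : ∀ i, IsPositiveHarris (closedLoop (Ts i) (γs i)))
    (hHarris : IsPositiveHarris (closedLoop T γ))
    (htight : IsTightMeasureSet (⋃ i, invariantMeasures (Ts i))) {c : X × U → ℝ}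
    (hc : Continuous c) {C : ℝ} (hC : ∀ p, |c p| ≤ C) (x₀ : X) :
    Tendsto (fun i => avgCost (Ts i) c x₀ (γs i).toAdmissible) l
      (𝓝 (avgCost T c x₀ γ.toAdmissible)) := by
  have hcb : BddMeasurable c := ⟨hc.measurable, C, hC⟩
  choose πs hπs using fun i => (hHarriss i).exists_invariant
  obtain ⟨π, hπ⟩ := hHarris.exists_invariant
  have htightπs : IsTightMeasureSet (Set.range fun i => (πs i : Measure X)) :=
    htight.subset (Set.range_subset_iff.2 fun i =>
      Set.mem_iUnion.2 ⟨i, inferInstance, γs i, hπs i⟩)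
  have hclosedLoop : TendstoContinuously (fun i => kernelAt (closedLoop (Ts i) (γs i)))
      (kernelAt (closedLoop T γ)) l := hTs.comp hγs.id_prodMk
  have hπlim : Tendsto πs l (𝓝 π) := tendsto_invariant hclosedLoop hπs htightπs
    fun ν hν => Subtype.ext (hHarris.isHarrisRecurrent.invariant_unique (π := ν) (π' := π) hν hπ)
  have hcost : TendstoContinuously (fun i x => c (x, (γs i).1 x)) (fun x => c (x, γ.1 x)) l :=
    (TendstoContinuously.const hc).comp hγs.id_prodMk
  simp only [avgCost_eq_integral _ _ (hHarriss _).isHarrisRecurrent (hπs _) hcb,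
    avgCost_eq_integral T γ hHarris.isHarrisRecurrent hπ hcb]
  exact hcost.tendsto_integral hπlim htightπs
    (fun i => hcb.measurable.comp (measurable_id.prodMk (γs i).2)) fun _ _ => hC _

end Robustness

end AvgCost

open AvgCost in
theorem mainTheorem5_general {X U : Type*} [MeasurableSpace X] [TopologicalSpace X] [T2Space X]
    [BorelSpace X] [HasOuterApproxClosed X] [MeasurableSpace U] [UniformSpace U] [CompactSpace U]
    [BorelSpace U] [OpensMeasurableSpace (X × U)] {ι : Type*} {l : Filter ι}
    {c : X × U → ℝ} (hc : Continuous c) {C : ℝ} (hC : ∀ p, |c p| ≤ C)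
    {T : Kernel (X × U) X} [IsMarkovKernel T]
    {Ts : ι → Kernel (X × U) X} [∀ i, IsMarkovKernel (Ts i)]
    (hTs : TendstoContinuously (fun i => kernelAt (Ts i)) (kernelAt T) l)
    (hHarris : ∀ γ : StationaryPolicy X U, Continuous γ.1 → IsPositiveHarris (closedLoop T γ))
    (hHarriss : ∀ i, ∀ γ : StationaryPolicy X U, Continuous γ.1 →
      IsPositiveHarris (closedLoop (Ts i) γ))
    (htight : IsTightMeasureSet (invariantMeasures T))
    (htights : IsTightMeasureSet (⋃ i, invariantMeasures (Ts i)))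
    (x₀ : X) {Γ : Set (AdmissiblePolicy X U)}
    (hΓ : ∀ γ : StationaryPolicy X U, Continuous γ.1 → γ.toAdmissible ∈ Γ)
    {γopt : StationaryPolicy X U} {γs : ι → StationaryPolicy X U}
    (hγopt : avgCost T c x₀ γopt.toAdmissible = optCost T c x₀ Γ)
    (hγs : ∀ i, avgCost (Ts i) c x₀ (γs i).toAdmissible = optCost (Ts i) c x₀ Γ)
    (hγopt_cont : Continuous γopt.1) (hγs_equi : Equicontinuous fun i => (γs i).1) :
    Tendsto (fun i => optCost (Ts i) c x₀ Γ) l (𝓝 (optCost T c x₀ Γ)) ∧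
      Tendsto (fun i => avgCost T c x₀ (γs i).toAdmissible) l (𝓝 (optCost T c x₀ Γ)) := by
  simp only [tendsto_iff_ultrafilter _ l, ← forall_and]
  intro l' hl'
  have hTl' := hTs.mono hl'
  have hTconst : TendstoContinuously (fun _ : ι => kernelAt T) (kernelAt T) l' :=
    .const (continuous_kernelAt_of_tendstoContinuously hTl')
  obtain ⟨g, hg⟩ := exists_tendstoContinuously_of_equicontinuous l' hγs_equi
  let γ : StationaryPolicy X U := ⟨g, hg.continuous.measurable⟩
  have hγ : IsPositiveHarris (closedLoop T γ) := hHarris γ hg.continuous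
  have hγs_cont := hγs_equi.continuous
  have hlim := tendsto_avgCost (γ := γ) hTl' hg (fun i => hHarriss i _ (hγs_cont i)) hγ htights
    hc hC x₀
  have hcompetitor := tendsto_avgCost hTl' (.const hγopt_cont)
    (fun i => hHarriss i γopt hγopt_cont) (hHarris γopt hγopt_cont) htights hc hC x₀
  have hrobust := tendsto_avgCost (γ := γ) hTconst hg (fun i => hHarris _ (hγs_cont i)) hγ
    (htight.subset (Set.iUnion_subset fun _ => le_rfl)) hc hC x₀
  have hγ_opt : avgCost T c x₀ γ.toAdmissible = optCost T c x₀ Γ :=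
    avgCost_eq_optCost_of_tendsto hC (hΓ γ hg.continuous) (hΓ γopt hγopt_cont) hγopt hγs hlim
      hcompetitor
  rw [hγ_opt] at hlim hrobust
  exact ⟨hlim.congr hγs, hrobust⟩

theorem mainTheorem5 {d m : ℕ}
    (X : Set (EuclideanSpace ℝ (Fin d))) (_hX : MeasurableSet X)
    (U : Set (EuclideanSpace ℝ (Fin m))) (hU : IsCompact U)
    (c : X × U → ℝ) (hc : Continuous c) (hcb : ∃ C : ℝ, ∀ p, |c p| ≤ C)
    (T : Kernel (X × U) X) [IsMarkovKernel T]
    (Tn : ℕ → Kernel (X × U) X) [∀ n, IsMarkovKernel (Tn n)]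
    -- weak continuity of the kernels in the state and the action
    (hT : Continuous (AvgCost.kernelAt T))
    (hTn : ∀ n, Continuous (AvgCost.kernelAt (Tn n)))
    -- continuous weak convergence of the kernels
    (hconv : ∀ (p : X × U) (q : ℕ → X × U), Tendsto q atTop (𝓝 p) →
      Tendsto (fun n => AvgCost.kernelAt (Tn n) (q n)) atTop (𝓝 (AvgCost.kernelAt T p)))
    -- positive Harris recurrence under every stationary policy
    (hHarris : ∀ γ : AvgCost.StationaryPolicy X U,
      AvgCost.IsPositiveHarris (AvgCost.closedLoop T γ))
    (hHarrisn : ∀ n, ∀ γ : AvgCost.StationaryPolicy X U,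
      AvgCost.IsPositiveHarris (AvgCost.closedLoop (Tn n) γ))
    -- tightness of the families of invariant measures
    (htight : IsTightMeasureSet (AvgCost.invariantMeasures T))
    (htightn : IsTightMeasureSet (⋃ n, AvgCost.invariantMeasures (Tn n)))
    -- the initial state and the class of policies over which the cost is minimized
    (x₀ : X) (Γ : Set (AvgCost.AdmissiblePolicy X U))
    (hΓ : ∀ γ : AvgCost.StationaryPolicy X U, γ.toAdmissible ∈ Γ)
    -- optimal stationary policies
    (γs : AvgCost.StationaryPolicy X U) (γn : ℕ → AvgCost.StationaryPolicy X U)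
    (hγs : AvgCost.avgCost T c x₀ γs.toAdmissible = AvgCost.optCost T c x₀ Γ)
    (hγn : ∀ n, AvgCost.avgCost (Tn n) c x₀ (γn n).toAdmissible
      = AvgCost.optCost (Tn n) c x₀ Γ)
    (hγs_cont : Continuous γs.1)
    (hγn_equi : Equicontinuous (fun n => (γn n).1)) :
    Tendsto (fun n => AvgCost.optCost (Tn n) c x₀ Γ) atTop (𝓝 (AvgCost.optCost T c x₀ Γ)) ∧
    Tendsto (fun n => AvgCost.avgCost T c x₀ (γn n).toAdmissible) atTop
      (𝓝 (AvgCost.optCost T c x₀ Γ)) := by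
  obtain ⟨C, hC⟩ := hcb
  have : CompactSpace U := isCompact_iff_compactSpace.1 hU
  exact mainTheorem5_general hc hC (.of_seq hconv) (fun γ _ => hHarris γ)
    (fun n γ _ => hHarrisn n γ) htight htightn x₀ (fun γ _ => hΓ γ) hγs hγn hγs_cont hγn_equi
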